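/- Let $a>1$ and $\mathbb T^2=\{(x,y,z)\in\mathbb R^3:(x^2+y^2-a^2)^2+z^2=1\}$. Let $f,K'\in\mathbb R[x,y,z]$ and $\beta,\gamma\in\mathbb R$, put $K=K'z$, and assume $\deg f\le 2$ and $\deg K\le 2$. Consider the polynomial vector field $\chi=(P,Q,R)$ with $$P=\tfrac14Kx+fy+\beta z,\qquad Q=\tfrac14Ky-fx+\gamma z,$$ $$R=\tfrac12K'\bigl(-a^2(x^2+y^2)+z^2+a^4-1\bigr)-2(\beta x+\gamma y)(x^2+y^2-a^2),$$ which is tangent to $\mathbb T^2$. A plane $mx+ny=0$, $(m,n)\ne(0,0)$, is invariant if $\chi(mx+ny)=k\,(mx+ny)$ for some $k\in\mathbb R[x,y,z]$, where $\chi g=Pg_x+Qg_y+Rg_z$. The meridian at angle $\theta$ is the set of points of $\mathbb T^2$ of the form $(r\cos\theta,r\sin\theta,z)$ with $r>0$; a plane $mx+ny=0$ meets $\mathbb T^2$ in two meridians, which are called invariant if the plane is invariant. A limit cycle is a periodic orbit of $\chi$ on $\mathbb T^2$ having a neighbourhood that meets no other periodic orbit of $\chi$ on $\mathbb T^2$.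 It is called stable if it is asymptotically (orbitally) stable for the flow of $\chi$ on $\mathbb T^2$, and unstable if it is asymptotically stable for the flow of $-\chi$ on $\mathbb T^2$. Suppose that $\chi$ has exactly four invariant meridians (counted as subsets of $\mathbb T^2$). Then each of them is a limit cycle if and only if $K'=0$ has no solution on it. In particular, all four are limit cycles if and only if $K'=0$ has no solution on any of them. In that case they are alternately stable and unstable: there are angles $\theta_0<\theta_1<\theta_2<\theta_3<\theta_0+2\pi$ such that the invariant meridians are exactly those at the angles $\theta_0,\dots,\theta_3$, the ones at $\theta_0,\theta_2$ are stable limit cycles, and the ones at $\theta_1,\theta_3$ are unstable limit cycles. -/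

import Mathlib

open MvPolynomial

/-- Euclidean three-space, with coordinates `x = p 0`, `y = p 1`, `z = p 2`. -/
abbrev E3 : Type := EuclideanSpace ℝ (Fin 3)

/-- Real polynomials in `x = X 0`, `y = X 1`, `z = X 2`. -/
abbrev Poly3 : Type := MvPolynomial (Fin 3) ℝ

/-- A polynomial vector field `(P, Q, R) = P ∂/∂x + Q ∂/∂y + R ∂/∂z` on `ℝ³`. -/
abbrev PolyField : Type := Fin 3 → Poly3

namespace PolyField

/-- The value of a polynomial at a point of `ℝ³`. -/
noncomputable def evalAt (g : Poly3) (p : E3) : ℝ := MvPolynomial.eval (fun i => p i) g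

/-- The map `ℝ³ → ℝ³` given by a polynomial vector field. -/
noncomputable def toMap (χ : PolyField) (p : E3) : E3 :=
  WithLp.toLp 2 (fun i => evalAt (χ i) p)

/-- The vector field as a derivation on polynomials: `χ g = P g_x + Q g_y + R g_z`. -/
noncomputable def applyPoly (χ : PolyField) (g : Poly3) : Poly3 :=
  ∑ i, χ i * pderiv i g

/-- The algebraic surface `{g = 0}` is invariant: `χ g = k g` for some polynomial cofactor `k`. -/
def IsInvariantSurface (χ : PolyField) (g : Poly3) : Prop :=
  ∃ k : Poly3, applyPoly χ g = k * g

/-- The torus `{(x² + y² - a²)² + z² = 1}` (used for `a > 1`). -/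
def torus (a : ℝ) : Set E3 :=
  {p | ((p 0) ^ 2 + (p 1) ^ 2 - a ^ 2) ^ 2 + (p 2) ^ 2 - 1 = 0}

/-- The cubic vector field on the torus with parameters `f`, `K'`, `β`, `γ`, where `K = K' z`:
`P = K x / 4 + f y + β z`, `Q = K y / 4 - f x + γ z`,
`R = K' (-a² (x² + y²) + z² + a⁴ - 1) / 2 - 2 (β x + γ y) (x² + y² - a²)`. -/
noncomputable def cubicField (a : ℝ) (f K' : Poly3) (β γ : ℝ) : PolyField :=
  ![C (1 / 4) * (K' * X 2) * X 0 + f * X 1 + C β * X 2,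
    C (1 / 4) * (K' * X 2) * X 1 - f * X 0 + C γ * X 2,
    C (1 / 2) * K' * (-C (a ^ 2) * (X 0 ^ 2 + X 1 ^ 2) + X 2 ^ 2 + C (a ^ 4 - 1))
      - C 2 * (C β * X 0 + C γ * X 1) * (X 0 ^ 2 + X 1 ^ 2 - C (a ^ 2))]

/-- The meridian of the torus at angle `θ`: the part of the torus on the open half-plane bounded
by the `z`-axis that contains the direction `(cos θ, sin θ, 0)`. A plane through the `z`-axis cuts
the torus in the two meridians at angles `θ` and `θ + π`. -/
def meridian (a θ : ℝ) : Set E3 :=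
  {p | p ∈ torus a ∧ ∃ r : ℝ, 0 < r ∧ p 0 = r * Real.cos θ ∧ p 1 = r * Real.sin θ}

/-- `Γ` is an invariant meridian: it is one of the two meridians cut out by a plane
`m x + n y = 0` which is invariant for `χ`. -/
def IsInvariantMeridian (a : ℝ) (χ : PolyField) (Γ : Set E3) : Prop :=
  ∃ m n : ℝ, (m, n) ≠ (0, 0) ∧ IsInvariantSurface χ (C m * X 0 + C n * X 1) ∧
    ∃ θ : ℝ, m * Real.cos θ + n * Real.sin θ = 0 ∧ Γ = meridian a θ

end PolyField

/-- `c` is a solution, defined for all times, of `c' = v(c)` that lies on `S`. (For a polynomial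
vector field tangent to a compact surface `S`, every solution starting on `S` is of this kind.) -/
def IsSolutionIn (v : E3 → E3) (S : Set E3) (c : ℝ → E3) : Prop :=
  IsIntegralCurve c (fun _ => v) ∧ ∀ t : ℝ, c t ∈ S

/-- `Γ` is a periodic orbit of `v` on `S`: the trajectory of a nonconstant periodic solution. -/
def IsPeriodicOrbit (v : E3 → E3) (S Γ : Set E3) : Prop :=
  ∃ c : ℝ → E3, IsSolutionIn v S c ∧ (∃ T : ℝ, 0 < T ∧ Function.Periodic c T) ∧
    (∃ t : ℝ, c t ≠ c 0) ∧ Set.range c = Γ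

/-- `Γ` is a limit cycle of `v` on `S`: a periodic orbit that is isolated among the periodic
orbits of `v` on `S`, i.e. some neighbourhood of `Γ` meets no other one. -/
def IsLimitCycle (v : E3 → E3) (S Γ : Set E3) : Prop :=
  IsPeriodicOrbit v S Γ ∧
    ∃ U : Set E3, IsOpen U ∧ Γ ⊆ U ∧
      ∀ Γ' : Set E3, IsPeriodicOrbit v S Γ' → (Γ' ∩ U).Nonempty → Γ' = Γ

/-- `Γ` is (orbitally) asymptotically stable for the flow of `v` on `S`: solutions starting close
to `Γ` stay close to `Γ` for all positive times and tend to `Γ` as `t → +∞`. -/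
def IsAsymptoticallyStable (v : E3 → E3) (S Γ : Set E3) : Prop :=
  (∀ ε : ℝ, 0 < ε → ∃ δ : ℝ, 0 < δ ∧ ∀ c : ℝ → E3, IsSolutionIn v S c →
      Metric.infDist (c 0) Γ < δ → ∀ t : ℝ, 0 ≤ t → Metric.infDist (c t) Γ < ε) ∧
  (∃ δ : ℝ, 0 < δ ∧ ∀ c : ℝ → E3, IsSolutionIn v S c → Metric.infDist (c 0) Γ < δ →
      Filter.Tendsto (fun t => Metric.infDist (c t) Γ) Filter.atTop (nhds 0))

/-- A stable limit cycle: it attracts the nearby trajectories as `t → +∞`. -/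
def IsStableLimitCycle (v : E3 → E3) (S Γ : Set E3) : Prop :=
  IsLimitCycle v S Γ ∧ IsAsymptoticallyStable v S Γ

/-- An unstable limit cycle: it attracts the nearby trajectories as `t → -∞`, that is, it is
asymptotically stable for the time-reversed field `-v`. -/
def IsUnstableLimitCycle (v : E3 → E3) (S Γ : Set E3) : Prop :=
  IsLimitCycle v S Γ ∧ IsAsymptoticallyStable (fun p => -v p) S Γ

/-!
Write `L_θ = x sin θ - y cos θ`, so that the meridian at angle `θ` lies in the plane `L_θ = 0`.
That plane is invariant exactly when `β sin θ = γ cos θ` and `f` vanishes on it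
(`IsInvariantAngle.evalAt_eq_zero`). Four invariant meridians make two invariant planes
`L_α = 0` and `L_δ = 0`, which forces `β = γ = 0` and, the degree of `f` being at most two,
`f = k L_α L_δ` with a constant `k`; it is nonzero, as all planes are invariant when `f = 0`
(`exists_normal_form`).

Along the flow `L_α` and `L_δ` then satisfy linear equations `L' = h L`, so each of them vanishes
identically or never on a solution, and their ratio `w = L_α / L_δ` satisfies
`w' = k sin (δ - α) (x² + y²) w` (`ratio_eq_mul_exp`). As `x² + y² ≥ a² - 1 > 0` on the torus, `w`
is strictly monotone where it is defined and nonzero, and every periodic orbit lies on an invariant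
meridian (`transverse_eq_zero_of_periodic`). On the meridian the field reads
`φ' = -K' (a² + cos φ) / 2` in the angle `φ` given by `x² + y² - a² = cos φ`, `z = sin φ`. If `K'`
has a zero there, that point is an equilibrium and the meridian is not an orbit; if not, the
equation is solved by inverting the primitive of the reciprocal of its right-hand side, and the
meridian is a periodic orbit, isolated by the above (`isLimitCycle_meridian_iff`).

If `k sin (δ - α) < 0` then `w` tends to zero exponentially, and both meridians in the plane
`L_α = 0` attract (`isAsymptoticallyStable_meridian`). Changing the sign of the field changes that
of `k`, so the two meridians in the plane `L_δ = 0` repel. The two planes alternate around the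
torus, and so do the stable and unstable meridians.
-/

/-! ### Scalar differential equations and uniqueness of solutions -/

/-- The solutions of the scalar linear equation `u' = h u`. -/
theorem eq_mul_exp_integral {h u : ℝ → ℝ} (hh : Continuous h)
    (hu : ∀ t, HasDerivAt u (h t * u t) t) (t₀ t : ℝ) :
    u t = u t₀ * Real.exp (∫ s in t₀..t, h s) := by
  have hI : ∀ t, HasDerivAt (fun t => ∫ s in t₀..t, h s) (h t) t := fun t =>
    intervalIntegral.integral_hasDerivAt_right (hh.intervalIntegrable _ _)
      hh.stronglyMeasurable.stronglyMeasurableAtFilter hh.continuousAt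
  have hconst : ∀ t, HasDerivAt (fun t => u t * Real.exp (-∫ s in t₀..t, h s)) 0 t := by
    intro t
    exact ((hu t).mul (hI t).neg.exp).congr_deriv (by simp only [Pi.neg_apply]; ring)
  have := is_const_of_deriv_eq_zero (fun t => (hconst t).differentiableAt)
    (fun t => (hconst t).deriv) t t₀
  simp only [intervalIntegral.integral_same, neg_zero, Real.exp_zero, mul_one] at this
  rw [← this, mul_assoc, ← Real.exp_add]
  simp

/-- The solution is the inverse of the primitive `G` of `1 / g`: the equation `φ' = g(φ)` says that
`G(φ(t)) = t` up to a constant. Its period is the time `G p` taken to run through one period of `g`. -/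
theorem exists_periodic_solution_of_pos {g : ℝ → ℝ} {p : ℝ} (hg : Continuous g)
    (hp : 0 < p) (hper : Function.Periodic g p) (hpos : ∀ x, 0 < g x) :
    ∃ h : ℝ → ℝ, Function.Surjective h ∧ (∀ t, HasDerivAt h (g (h t)) t) ∧
      ∃ T : ℝ, 0 < T ∧ ∀ t, h (t + T) = h t + p := by
  have hgi : Continuous fun x => (g x)⁻¹ := hg.inv₀ fun x => (hpos x).ne'
  have hgip : Function.Periodic (fun x => (g x)⁻¹) p := fun x => by simp [hper x]
  set G : ℝ → ℝ := fun x => ∫ s in (0 : ℝ)..x, (g s)⁻¹ with hG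
  have hGd : ∀ x, HasDerivAt G (g x)⁻¹ x := fun x =>
    intervalIntegral.integral_hasDerivAt_right (hgi.intervalIntegrable _ _)
      hgi.stronglyMeasurable.stronglyMeasurableAtFilter hgi.continuousAt
  have hGc : Continuous G := continuous_iff_continuousAt.2 fun x => (hGd x).continuousAt
  have hGm : StrictMono G := strictMono_of_deriv_pos fun x => by
    rw [(hGd x).deriv]; exact inv_pos.2 (hpos x)
  have hG0 : G 0 = 0 := by simp [hG]
  have hT : 0 < G p := hG0 ▸ hGm hp
  have hGadd : ∀ x, G (x + p) = G x + G p := by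
    intro x
    have h1 := intervalIntegral.integral_add_adjacent_intervals
      (hgi.intervalIntegrable (μ := MeasureTheory.volume) 0 x)
      (hgi.intervalIntegrable (μ := MeasureTheory.volume) x (x + p))
    have h2 := hgip.intervalIntegral_add_eq x 0
    rw [zero_add] at h2
    simp only [hG]
    rw [← h1, h2]
  have hnat : ∀ n : ℕ, G (n * p) = n * G p := by
    intro n
    induction n with
    | zero => simp [hG0]
    | succ n ih => push_cast; rw [add_mul, one_mul, hGadd, ih]; ring
  have hnat' : ∀ n : ℕ, G (-(n * p)) = -(n * G p) := by
    intro n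
    induction n with
    | zero => simp [hG0]
    | succ n ih =>
      have := hGadd (-((n + 1 : ℕ) * p))
      have e : -((n + 1 : ℕ) * p) + p = -(n * p) := by push_cast; ring
      rw [e, ih] at this
      push_cast at *
      linarith
  have hsurj : Function.Surjective G := by
    intro y
    obtain ⟨n, hn⟩ := exists_nat_gt (|y| / G p)
    rw [div_lt_iff₀ hT] at hn
    obtain ⟨h1, h2⟩ := abs_lt.1 hn
    have hle : -(n * p) ≤ n * p := by
      have : 0 ≤ n * p := by positivity
      linarith
    obtain ⟨x, -, hx⟩ := intermediate_value_Icc hle hGc.continuousOn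
      (show y ∈ Set.Icc (G (-(n * p))) (G (n * p)) by
        rw [hnat, hnat']; exact ⟨h1.le, h2.le⟩)
    exact ⟨x, hx⟩
  set e : ℝ ≃o ℝ := StrictMono.orderIsoOfSurjective G hGm hsurj with he
  have heG : ∀ t, G (e.symm t) = t := fun t => e.apply_symm_apply t
  refine ⟨e.symm, e.symm.surjective, fun t => ?_, G p, hT, fun t => ?_⟩
  · simpa using (hGd (e.symm t)).of_local_left_inverse e.symm.continuous.continuousAt
      (inv_ne_zero (hpos _).ne') (Filter.Eventually.of_forall heG)
  · apply hGm.injective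
    rw [heG, hGadd, heG]

/-- A scalar equation `φ' = g(φ)` with `g` periodic and without zeros has a global solution that runs
through all of `ℝ` and crosses one period of `g`, in one direction or the other, in a fixed time. -/
theorem exists_periodic_solution {g : ℝ → ℝ} {p : ℝ} (hg : Continuous g)
    (hp : 0 < p) (hper : Function.Periodic g p) (hne : ∀ x, g x ≠ 0) :
    ∃ h : ℝ → ℝ, Function.Surjective h ∧ (∀ t, HasDerivAt h (g (h t)) t) ∧
      ∃ T : ℝ, 0 < T ∧ ∀ t, h (t + T) = h t + p ∨ h (t + T) = h t - p := by
  by_cases h0 : 0 < g 0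
  · have hpos : ∀ x, 0 < g x := by
      intro x
      by_contra hx
      obtain ⟨y, -, hy⟩ := intermediate_value_uIcc (a := 0) (b := x) hg.continuousOn
        (Set.mem_uIcc.2 (Or.inr ⟨not_lt.1 hx, h0.le⟩))
      exact hne y hy
    obtain ⟨h, h1, h2, T, h3, h4⟩ := exists_periodic_solution_of_pos hg hp hper hpos
    exact ⟨h, h1, h2, T, h3, fun t => Or.inl (h4 t)⟩
  · have hneg : ∀ x, 0 < -g x := by
      intro x
      by_contra hx
      obtain ⟨y, -, hy⟩ := intermediate_value_uIcc (a := 0) (b := x) hg.continuousOn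
        (Set.mem_uIcc.2 (Or.inl ⟨not_lt.1 h0, by linarith⟩))
      exact hne y hy
    obtain ⟨h, h1, h2, T, h3, h4⟩ := exists_periodic_solution_of_pos hg.neg hp
      (fun x => by simp [hper x]) hneg
    refine ⟨fun t => h (-t), h1.comp neg_surjective, fun t => ?_, T, h3, fun t => Or.inr ?_⟩
    · exact ((h2 (-t)).scomp t (hasDerivAt_neg t)).congr_deriv (by simp)
    · have := h4 (-(t + T))
      rw [neg_add, neg_add_cancel_right] at this
      simp only [neg_add]
      linarith

theorem IsSolutionIn.eq_of_apply_eq {v : E3 → E3} {S : Set E3} (hv : ContDiff ℝ 1 v)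
    (hS : IsCompact S) {c c' : ℝ → E3} (hc : IsSolutionIn v S c) (hc' : IsSolutionIn v S c')
    {t₀ : ℝ} (h : c t₀ = c' t₀) : c = c' := by
  obtain ⟨K, hK⟩ := (hv.locallyLipschitz.locallyLipschitzOn (s := S)).exists_lipschitzOnWith_of_compact hS
  exact ODE_solution_unique_univ (v := fun _ => v) (s := fun _ => S) (fun _ => hK)
    (fun t => ⟨hc.1 t, hc.2 t⟩) (fun t => ⟨hc'.1 t, hc'.2 t⟩) h

namespace PolyField

/-! ### Regularity of the field and compactness of the torus -/

theorem contDiff_evalAt (g : Poly3) : ContDiff ℝ 1 (evalAt g) := by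
  have h := AnalyticOnNhd.aeval_mvPolynomial (𝕜 := ℝ) (s := Set.univ)
    (f := fun (p : E3) i => p i) (fun i => (EuclideanSpace.proj i : E3 →L[ℝ] ℝ).analyticOnNhd _) g
  have h2 := h.contDiff (n := 1)
  exact h2

theorem continuous_evalAt (g : Poly3) : Continuous (evalAt g) := (contDiff_evalAt g).continuous

theorem contDiff_toMap (χ : PolyField) : ContDiff ℝ 1 χ.toMap :=
  contDiff_euclidean.2 fun i => contDiff_evalAt (χ i)

theorem isCompact_torus (a : ℝ) : IsCompact (torus a) := by
  refine Metric.isCompact_of_isClosed_isBounded ?_ ?_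
  · exact isClosed_eq (by fun_prop) continuous_const
  · refine (Metric.isBounded_closedBall (x := (0 : E3)) (r := a ^ 2 + 2)).subset fun p hp => ?_
    have hp' : ((p 0) ^ 2 + (p 1) ^ 2 - a ^ 2) ^ 2 + (p 2) ^ 2 - 1 = 0 := hp
    rw [mem_closedBall_zero_iff, EuclideanSpace.norm_eq]
    refine Real.sqrt_le_iff.2 ⟨by positivity, ?_⟩
    simp only [Fin.sum_univ_three, Real.norm_eq_abs, sq_abs]
    nlinarith [sq_nonneg ((p 0) ^ 2 + (p 1) ^ 2 - a ^ 2 - 1), sq_nonneg a, sq_nonneg (p 2)]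

theorem radius_sq_bounds {a : ℝ} {p : E3} (hp : p ∈ torus a) :
    a ^ 2 - 1 ≤ p 0 ^ 2 + p 1 ^ 2 ∧ p 0 ^ 2 + p 1 ^ 2 ≤ a ^ 2 + 1 := by
  have hp' : ((p 0) ^ 2 + (p 1) ^ 2 - a ^ 2) ^ 2 + (p 2) ^ 2 - 1 = 0 := hp
  have h := abs_le_of_sq_le_sq' (show (p 0 ^ 2 + p 1 ^ 2 - a ^ 2) ^ 2 ≤ 1 ^ 2 by
    nlinarith [sq_nonneg (p 2)]) zero_le_one
  constructor <;> linarith [h.1, h.2]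

/-! ### Planes through the axis and meridians -/

/-- The linear form `x sin θ - y cos θ`, which vanishes on the plane through the `z`-axis
containing the meridian at angle `θ`. -/
noncomputable def transverse (θ : ℝ) (p : E3) : ℝ := p 0 * Real.sin θ - p 1 * Real.cos θ

/-- The linear form `x cos θ + y sin θ`, which separates the meridian at angle `θ` from the
opposite one. -/
noncomputable def radial (θ : ℝ) (p : E3) : ℝ := p 0 * Real.cos θ + p 1 * Real.sin θ

theorem continuous_transverse (θ : ℝ) : Continuous (transverse θ) := by
  unfold transverse; fun_prop

theorem continuous_radial (θ : ℝ) : Continuous (radial θ) := by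
  unfold radial; fun_prop

theorem transverse_add_pi (θ : ℝ) (p : E3) : transverse (θ + Real.pi) p = -transverse θ p := by
  simp only [transverse, Real.sin_add_pi, Real.cos_add_pi]; ring

theorem radial_sq_add_transverse_sq (θ : ℝ) (p : E3) :
    radial θ p ^ 2 + transverse θ p ^ 2 = p 0 ^ 2 + p 1 ^ 2 := by
  simp only [radial, transverse]
  linear_combination (p 0 ^ 2 + p 1 ^ 2) * Real.sin_sq_add_cos_sq θ

theorem radial_mul_transverse_sub (α β : ℝ) (p : E3) :
    radial α p * transverse β p - transverse α p * radial β p =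
      Real.sin (β - α) * (p 0 ^ 2 + p 1 ^ 2) := by
  simp only [radial, transverse, Real.sin_sub]
  ring

theorem transverse_eq (α β : ℝ) (p : E3) :
    transverse β p = radial α p * Real.sin (β - α) + transverse α p * Real.cos (β - α) := by
  simp only [radial, transverse, Real.sin_sub, Real.cos_sub]
  linear_combination (-(p 0 * Real.sin β) + p 1 * Real.cos β) * Real.sin_sq_add_cos_sq α

theorem mem_meridian_iff {a θ : ℝ} {p : E3} :
    p ∈ meridian a θ ↔ p ∈ torus a ∧ transverse θ p = 0 ∧ 0 < radial θ p := by
  refine and_congr_right fun _ => ⟨?_, ?_⟩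
  · rintro ⟨r, hr, h0, h1⟩
    simp only [transverse, radial, h0, h1]
    refine ⟨by ring, ?_⟩
    have : r * Real.cos θ * Real.cos θ + r * Real.sin θ * Real.sin θ = r := by
      linear_combination r * Real.sin_sq_add_cos_sq θ
    rwa [this]
  · rintro ⟨h0, h1⟩
    refine ⟨radial θ p, h1, ?_, ?_⟩
    · simp only [transverse, radial] at *
      linear_combination Real.sin θ * h0 - p 0 * Real.sin_sq_add_cos_sq θ
    · simp only [transverse, radial] at *
      linear_combination -Real.cos θ * h0 - p 1 * Real.sin_sq_add_cos_sq θ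

/-- The parametrization `φ ↦ (√(a² + cos φ) cos θ, √(a² + cos φ) sin θ, sin φ)` of the meridian
at angle `θ`. -/
noncomputable def meridianParam (a θ φ : ℝ) : E3 :=
  !₂[√(a ^ 2 + Real.cos φ) * Real.cos θ, √(a ^ 2 + Real.cos φ) * Real.sin θ, Real.sin φ]

@[simp] theorem meridianParam_zero (a θ φ : ℝ) :
    meridianParam a θ φ 0 = √(a ^ 2 + Real.cos φ) * Real.cos θ := rfl

@[simp] theorem meridianParam_one (a θ φ : ℝ) :
    meridianParam a θ φ 1 = √(a ^ 2 + Real.cos φ) * Real.sin θ := rfl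

@[simp] theorem meridianParam_two (a θ φ : ℝ) : meridianParam a θ φ 2 = Real.sin φ := rfl

theorem continuous_meridianParam (a θ : ℝ) : Continuous (meridianParam a θ) := by
  unfold meridianParam
  refine (PiLp.continuous_toLp 2 _).comp (continuous_pi fun i => ?_)
  fin_cases i <;> simp <;> fun_prop

theorem periodic_meridianParam (a θ : ℝ) :
    Function.Periodic (meridianParam a θ) (2 * Real.pi) := fun φ => by
  simp [meridianParam]

theorem sq_add_cos_pos {a : ℝ} (ha : 1 < a) (φ : ℝ) : 0 < a ^ 2 + Real.cos φ := by
  nlinarith [Real.neg_one_le_cos φ]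

theorem range_meridianParam {a : ℝ} (ha : 1 < a) (θ : ℝ) :
    Set.range (meridianParam a θ) = meridian a θ := by
  ext p
  constructor
  · rintro ⟨φ, rfl⟩
    have h := sq_add_cos_pos ha φ
    refine ⟨?_, √(a ^ 2 + Real.cos φ), Real.sqrt_pos.2 h, rfl, rfl⟩
    simp only [torus, Set.mem_ofPred_eq, meridianParam_zero, meridianParam_one, meridianParam_two,
      mul_pow, Real.sq_sqrt h.le]
    have e : (a ^ 2 + Real.cos φ) * Real.cos θ ^ 2 + (a ^ 2 + Real.cos φ) * Real.sin θ ^ 2 - a ^ 2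
        = Real.cos φ := by
      linear_combination (a ^ 2 + Real.cos φ) * Real.sin_sq_add_cos_sq θ
    rw [e]
    linear_combination Real.sin_sq_add_cos_sq φ
  · rintro ⟨hp, r, hr, h0, h1⟩
    have hr2 : p 0 ^ 2 + p 1 ^ 2 = r ^ 2 := by
      rw [h0, h1]; linear_combination r ^ 2 * Real.sin_sq_add_cos_sq θ
    have hp' : ((p 0) ^ 2 + (p 1) ^ 2 - a ^ 2) ^ 2 + (p 2) ^ 2 - 1 = 0 := hp
    rw [hr2] at hp'
    -- the point `(r² - a², z)` lies on the unit circle, and `φ` is its argument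
    have hz : ‖(⟨r ^ 2 - a ^ 2, p 2⟩ : ℂ)‖ = 1 := by
      rw [Complex.norm_def, Complex.normSq_mk, Real.sqrt_eq_one]; linarith
    have hz0 : (⟨r ^ 2 - a ^ 2, p 2⟩ : ℂ) ≠ 0 := by
      rw [← norm_ne_zero_iff, hz]; exact one_ne_zero
    refine ⟨Complex.arg ⟨r ^ 2 - a ^ 2, p 2⟩, ?_⟩
    have hc : √(a ^ 2 + Real.cos (Complex.arg ⟨r ^ 2 - a ^ 2, p 2⟩)) = r := by
      rw [Complex.cos_arg hz0, hz]
      simp [Real.sqrt_sq hr.le]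
    ext i
    fin_cases i
    · change √_ * _ = p 0
      rw [hc, h0]
    · change √_ * _ = p 1
      rw [hc, h1]
    · change Real.sin _ = p 2
      rw [Complex.sin_arg, hz]; simp

theorem isCompact_meridian {a : ℝ} (ha : 1 < a) (θ : ℝ) : IsCompact (meridian a θ) := by
  rw [← range_meridianParam ha]
  exact (periodic_meridianParam a θ).compact_of_continuous Real.two_pi_pos.ne'
    (continuous_meridianParam a θ)

theorem meridian_nonempty {a : ℝ} (ha : 1 < a) (θ : ℝ) : (meridian a θ).Nonempty := by
  rw [← range_meridianParam ha]
  exact Set.range_nonempty _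

theorem cos_eq_and_sin_eq_of_meridian_eq {a : ℝ} (ha : 1 < a) {θ θ' : ℝ}
    (h : meridian a θ = meridian a θ') : Real.cos θ = Real.cos θ' ∧ Real.sin θ = Real.sin θ' := by
  have hmem : meridianParam a θ 0 ∈ meridian a θ' := by
    rw [← h, ← range_meridianParam ha]; exact Set.mem_range_self _
  have hpos : 0 < √(a ^ 2 + Real.cos 0) := Real.sqrt_pos.2 (sq_add_cos_pos ha 0)
  obtain ⟨-, r, hr, h0, h1⟩ := hmem
  rw [meridianParam_zero] at h0
  rw [meridianParam_one] at h1
  have hsq : √(a ^ 2 + Real.cos 0) ^ 2 = r ^ 2 := by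
    calc _ = (√(a ^ 2 + Real.cos 0) * Real.cos θ) ^ 2 + (√(a ^ 2 + Real.cos 0) * Real.sin θ) ^ 2 := by
          linear_combination (-√(a ^ 2 + Real.cos 0) ^ 2) * Real.sin_sq_add_cos_sq θ
      _ = r ^ 2 := by
          rw [h0, h1]; linear_combination r ^ 2 * Real.sin_sq_add_cos_sq θ'
  have heq : √(a ^ 2 + Real.cos 0) = r := (pow_left_inj₀ hpos.le hr.le two_ne_zero).1 hsq
  rw [heq] at h0 h1
  exact ⟨mul_left_cancel₀ hr.ne' h0, mul_left_cancel₀ hr.ne' h1⟩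

theorem meridian_congr {a θ θ' : ℝ} (hc : Real.cos θ = Real.cos θ')
    (hs : Real.sin θ = Real.sin θ') : meridian a θ = meridian a θ' := by
  simp only [meridian, hc, hs]

theorem meridian_add_two_pi (a θ : ℝ) : meridian a (θ + 2 * Real.pi) = meridian a θ :=
  meridian_congr (Real.cos_add_two_pi θ) (Real.sin_add_two_pi θ)

/-! ### The field in coordinates -/

theorem evalAt_cubicField_zero (a : ℝ) (f K' : Poly3) (β γ : ℝ) (p : E3) :
    evalAt (cubicField a f K' β γ 0) p =
      1 / 4 * (evalAt K' p * p 2) * p 0 + evalAt f p * p 1 + β * p 2 := by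
  simp [evalAt, cubicField]

theorem evalAt_cubicField_one (a : ℝ) (f K' : Poly3) (β γ : ℝ) (p : E3) :
    evalAt (cubicField a f K' β γ 1) p =
      1 / 4 * (evalAt K' p * p 2) * p 1 - evalAt f p * p 0 + γ * p 2 := by
  simp [evalAt, cubicField]

theorem evalAt_cubicField_two (a : ℝ) (f K' : Poly3) (β γ : ℝ) (p : E3) :
    evalAt (cubicField a f K' β γ 2) p =
      1 / 2 * evalAt K' p * (-a ^ 2 * (p 0 ^ 2 + p 1 ^ 2) + p 2 ^ 2 + (a ^ 4 - 1))
        - 2 * (β * p 0 + γ * p 1) * (p 0 ^ 2 + p 1 ^ 2 - a ^ 2) := by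
  simp [evalAt, cubicField]

/-- Time reversal stays in the same family of fields. -/
theorem neg_toMap_cubicField (a : ℝ) (f K' : Poly3) (β γ : ℝ) :
    (fun p => -(cubicField a f K' β γ).toMap p) =
      (cubicField a (-f) (-K') (-β) (-γ)).toMap := by
  funext p
  ext i
  have hn : ∀ g : Poly3, evalAt (-g) p = -evalAt g p := fun g => by simp [evalAt]
  fin_cases i
  · change -evalAt (cubicField a f K' β γ 0) p = evalAt (cubicField a (-f) (-K') (-β) (-γ) 0) p
    rw [evalAt_cubicField_zero, evalAt_cubicField_zero, hn, hn]; ring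
  · change -evalAt (cubicField a f K' β γ 1) p = evalAt (cubicField a (-f) (-K') (-β) (-γ) 1) p
    rw [evalAt_cubicField_one, evalAt_cubicField_one, hn, hn]; ring
  · change -evalAt (cubicField a f K' β γ 2) p = evalAt (cubicField a (-f) (-K') (-β) (-γ) 2) p
    rw [evalAt_cubicField_two, evalAt_cubicField_two, hn]; ring

theorem hasDerivAt_coord {v : E3 → E3} {S : Set E3} {c : ℝ → E3} (hc : IsSolutionIn v S c)
    (i : Fin 3) (t : ℝ) : HasDerivAt (fun t => c t i) (v (c t) i) t :=
  (EuclideanSpace.proj i : E3 →L[ℝ] ℝ).hasFDerivAt.comp_hasDerivAt t (hc.1 t)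

theorem hasDerivAt_transverse {a : ℝ} {f K' : Poly3} {S : Set E3} {c : ℝ → E3}
    (hc : IsSolutionIn (cubicField a f K' 0 0).toMap S c) (θ t : ℝ) :
    HasDerivAt (fun t => transverse θ (c t))
      (1 / 4 * evalAt K' (c t) * c t 2 * transverse θ (c t) +
        evalAt f (c t) * radial θ (c t)) t := by
  have h0 : HasDerivAt (fun t => c t 0) (evalAt (cubicField a f K' 0 0 0) (c t)) t :=
    hasDerivAt_coord hc 0 t
  have h1 : HasDerivAt (fun t => c t 1) (evalAt (cubicField a f K' 0 0 1) (c t)) t :=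
    hasDerivAt_coord hc 1 t
  rw [evalAt_cubicField_zero] at h0
  rw [evalAt_cubicField_one] at h1
  exact ((h0.mul_const (Real.sin θ)).sub (h1.mul_const (Real.cos θ))).congr_deriv (by
    simp only [transverse, radial]; ring)

/-- A linear form dividing `f` keeps its sign, or stays zero, along a solution. -/
theorem transverse_eq_mul_pos {a : ℝ} {f K' : Poly3} {S : Set E3} {c : ℝ → E3}
    (hc : IsSolutionIn (cubicField a f K' 0 0).toMap S c) {θ : ℝ} {g : E3 → ℝ}
    (hg : Continuous g) (hf : ∀ p, evalAt f p = g p * transverse θ p) (t₀ t : ℝ) :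
    ∃ E : ℝ, 0 < E ∧ transverse θ (c t) = transverse θ (c t₀) * E := by
  have hcc : Continuous c := hc.1.continuous
  have hK := (continuous_evalAt K').comp hcc
  have hgc := hg.comp hcc
  have hr := (continuous_radial θ).comp hcc
  refine ⟨_, Real.exp_pos _, eq_mul_exp_integral (u := fun t => transverse θ (c t))
    (h := fun t => 1 / 4 * evalAt K' (c t) * c t 2 + g (c t) * radial θ (c t)) ?_ (fun t => ?_) t₀ t⟩
  · simp only [Function.comp_def] at *
    fun_prop
  · refine (hasDerivAt_transverse hc θ t).congr_deriv ?_
    rw [hf]; ring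

theorem ratio_eq_mul_exp {a k α β : ℝ} {f K' : Poly3} {S : Set E3} {c : ℝ → E3}
    (hc : IsSolutionIn (cubicField a f K' 0 0).toMap S c)
    (hf : ∀ p, evalAt f p = k * transverse α p * transverse β p)
    (hne : ∀ t, transverse β (c t) ≠ 0) (t₀ t : ℝ) :
    transverse α (c t) / transverse β (c t) = transverse α (c t₀) / transverse β (c t₀) *
      Real.exp (∫ s in t₀..t, k * Real.sin (β - α) * (c s 0 ^ 2 + c s 1 ^ 2)) := by
  have hcc : Continuous c := hc.1.continuous
  refine eq_mul_exp_integral (u := fun t => transverse α (c t) / transverse β (c t))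
    (h := fun s => k * Real.sin (β - α) * (c s 0 ^ 2 + c s 1 ^ 2)) (by fun_prop) (fun t => ?_) t₀ t
  refine ((hasDerivAt_transverse hc α t).div (hasDerivAt_transverse hc β t) (hne t)).congr_deriv ?_
  have := hne t
  rw [hf]
  field_simp
  linear_combination 4 * k * transverse α (c t) * radial_mul_transverse_sub α β (c t)

theorem integral_radius_sq_ge {a : ℝ} {c : ℝ → E3} (hcc : Continuous c)
    (hc : ∀ t, c t ∈ torus a) {t : ℝ} (ht : 0 ≤ t) :
    (a ^ 2 - 1) * t ≤ ∫ s in (0 : ℝ)..t, (c s 0 ^ 2 + c s 1 ^ 2) := by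
  have := intervalIntegral.integral_mono_on (μ := MeasureTheory.volume) (f := fun _ => a ^ 2 - 1)
    (g := fun s => c s 0 ^ 2 + c s 1 ^ 2) ht
    (continuous_const.intervalIntegrable _ _)
    ((by fun_prop : Continuous fun s => c s 0 ^ 2 + c s 1 ^ 2).intervalIntegrable _ _)
    (fun s _ => (radius_sq_bounds (hc s)).1)
  simp only [intervalIntegral.integral_const, sub_zero, smul_eq_mul] at this
  linarith

/-! ### Periodic orbits -/

/-- On a plane through the `z`-axis where `f` vanishes, the flow on the meridian is
`φ' = -K' (a² + cos φ) / 2` in the angle `φ`, so it is periodic as soon as `K'` has no zero. -/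
theorem exists_periodic_solution_on_meridian {a θ : ℝ} (ha : 1 < a) {f K' : Poly3}
    (hf : ∀ p ∈ meridian a θ, evalAt f p = 0) (hK : ∀ p ∈ meridian a θ, evalAt K' p ≠ 0) :
    ∃ c : ℝ → E3, IsSolutionIn (cubicField a f K' 0 0).toMap (torus a) c ∧
      (∃ T : ℝ, 0 < T ∧ Function.Periodic c T) ∧ Set.range c = meridian a θ := by
  have hmem : ∀ φ, meridianParam a θ φ ∈ meridian a θ := fun φ =>
    range_meridianParam ha θ ▸ Set.mem_range_self φ
  obtain ⟨h, hsurj, hder, T, hT, hper⟩ := exists_periodic_solution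
    (g := fun φ => -(1 / 2) * evalAt K' (meridianParam a θ φ) * (a ^ 2 + Real.cos φ))
    (p := 2 * Real.pi)
    (by
      have := (continuous_evalAt K').comp (continuous_meridianParam a θ)
      simp only [Function.comp_def] at this
      fun_prop)
    Real.two_pi_pos
    (fun φ => by simp only [periodic_meridianParam a θ φ, Real.cos_add_two_pi])
    (fun φ => mul_ne_zero (mul_ne_zero (by norm_num) (hK _ (hmem φ))) (sq_add_cos_pos ha φ).ne')
  refine ⟨fun t => meridianParam a θ (h t), ⟨fun t => ?_, fun t => (hmem _).1⟩,
    ⟨T, hT, fun t => ?_⟩, ?_⟩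
  · have hpos := sq_add_cos_pos ha (h t)
    have hf0 := hf _ (hmem (h t))
    have hs : HasDerivAt (fun t => √(a ^ 2 + Real.cos (h t)))
        (1 / 4 * evalAt K' (meridianParam a θ (h t)) * Real.sin (h t) *
          √(a ^ 2 + Real.cos (h t))) t := by
      refine (((hder t).cos.const_add (a ^ 2)).sqrt hpos.ne').congr_deriv ?_
      have hq := Real.sq_sqrt hpos.le
      have hq0 := (Real.sqrt_pos.2 hpos).ne'
      field_simp
      rw [hq]
      ring
    have hpi : HasDerivAt (fun t => WithLp.ofLp (meridianParam a θ (h t)))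
        (WithLp.ofLp ((cubicField a f K' 0 0).toMap (meridianParam a θ (h t)))) t := by
      refine hasDerivAt_pi.2 fun i => ?_
      fin_cases i
      · change HasDerivAt (fun t => √(a ^ 2 + Real.cos (h t)) * Real.cos θ)
          (evalAt (cubicField a f K' 0 0 0) (meridianParam a θ (h t))) t
        refine (hs.mul_const _).congr_deriv ?_
        rw [evalAt_cubicField_zero, hf0, meridianParam_zero, meridianParam_two]
        ring
      · change HasDerivAt (fun t => √(a ^ 2 + Real.cos (h t)) * Real.sin θ)
          (evalAt (cubicField a f K' 0 0 1) (meridianParam a θ (h t))) t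
        refine (hs.mul_const _).congr_deriv ?_
        rw [evalAt_cubicField_one, hf0, meridianParam_one, meridianParam_two]
        ring
      · change HasDerivAt (fun t => Real.sin (h t))
          (evalAt (cubicField a f K' 0 0 2) (meridianParam a θ (h t))) t
        refine (hder t).sin.congr_deriv ?_
        have hq := Real.sq_sqrt hpos.le
        rw [evalAt_cubicField_two, meridianParam_zero, meridianParam_one, meridianParam_two]
        have e : (√(a ^ 2 + Real.cos (h t)) * Real.cos θ) ^ 2 +
            (√(a ^ 2 + Real.cos (h t)) * Real.sin θ) ^ 2 = a ^ 2 + Real.cos (h t) := by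
          rw [mul_pow, mul_pow, hq]
          linear_combination (a ^ 2 + Real.cos (h t)) * Real.sin_sq_add_cos_sq θ
        rw [e]
        linear_combination -(1 / 2) * evalAt K' (meridianParam a θ (h t)) *
          Real.sin_sq_add_cos_sq (h t)
    exact (PiLp.hasFDerivAt_toLp 2 _).comp_hasDerivAt t hpi
  · rcases hper t with e | e
    · simp only [e, periodic_meridianParam a θ (h t)]
    · simp only [e, (periodic_meridianParam a θ).sub_eq]
  · rw [← range_meridianParam ha, ← hsurj.range_comp (meridianParam a θ)]
    rfl

theorem forall_transverse_eq_zero {a : ℝ} {f K' : Poly3} {S : Set E3} {c : ℝ → E3}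
    (hc : IsSolutionIn (cubicField a f K' 0 0).toMap S c) {θ : ℝ} {g : E3 → ℝ}
    (hg : Continuous g) (hf : ∀ p, evalAt f p = g p * transverse θ p) {t₀ : ℝ}
    (h0 : transverse θ (c t₀) = 0) (t : ℝ) : transverse θ (c t) = 0 := by
  obtain ⟨E, -, hE⟩ := transverse_eq_mul_pos hc hg hf t₀ t
  rw [hE, h0, zero_mul]

/-- If `f` is a multiple of the two forms `transverse α` and `transverse β`, every periodic orbit
lies in one of the two planes: off these planes the ratio of the forms is strictly monotone along
the flow. -/
theorem transverse_eq_zero_of_periodic {a k α β : ℝ} (ha : 1 < a) {f K' : Poly3}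
    (hf : ∀ p, evalAt f p = k * transverse α p * transverse β p)
    (hk : k * Real.sin (β - α) ≠ 0) {c : ℝ → E3}
    (hc : IsSolutionIn (cubicField a f K' 0 0).toMap (torus a) c) {T : ℝ} (hT : 0 < T)
    (hper : Function.Periodic c T) :
    (∀ t, transverse α (c t) = 0) ∨ ∀ t, transverse β (c t) = 0 := by
  by_contra! hne
  obtain ⟨⟨t₁, h₁⟩, t₂, h₂⟩ := hne
  have hα : ∀ t, transverse α (c t) ≠ 0 := fun t h => h₁ (forall_transverse_eq_zero hc
    (g := fun p => k * transverse β p) ((continuous_transverse β).const_mul k |>.congr fun _ => rfl)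
    (fun p => by rw [hf]; ring) h t₁)
  have hβ : ∀ t, transverse β (c t) ≠ 0 := fun t h => h₂ (forall_transverse_eq_zero hc
    (g := fun p => k * transverse α p) ((continuous_transverse α).const_mul k |>.congr fun _ => rfl)
    (fun p => by rw [hf]) h t₂)
  have hr := ratio_eq_mul_exp hc hf hβ 0 T
  have hcT : c T = c 0 := by simpa using hper 0
  rw [hcT, eq_comm, mul_eq_left₀ (div_ne_zero (hα 0) (hβ 0)), Real.exp_eq_one_iff,
    intervalIntegral.integral_const_mul] at hr
  have hpos : 0 < (a ^ 2 - 1) * T := mul_pos (by nlinarith) hT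
  exact mul_ne_zero hk (hpos.trans_le (integral_radius_sq_ge hc.1.continuous hc.2 hT.le)).ne' hr

theorem mem_meridian_of_transverse_eq_zero {a θ : ℝ} (ha : 1 < a) {c : ℝ → E3}
    (hcc : Continuous c) (hc : ∀ t, c t ∈ torus a) (h0 : ∀ t, transverse θ (c t) = 0) {t₀ : ℝ}
    (hpos : 0 < radial θ (c t₀)) (t : ℝ) : c t ∈ meridian a θ := by
  refine mem_meridian_iff.2 ⟨hc t, h0 t, ?_⟩
  by_contra hneg
  obtain ⟨s, -, hs⟩ := intermediate_value_uIcc (a := t) (b := t₀)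
    (f := fun t => radial θ (c t)) ((continuous_radial θ).comp hcc).continuousOn
    (Set.mem_uIcc.2 (Or.inl ⟨not_lt.1 hneg, hpos.le⟩))
  have h1 := radial_sq_add_transverse_sq θ (c s)
  simp only at hs
  rw [hs, h0] at h1
  have h2 := (radius_sq_bounds (hc s)).1
  nlinarith

/-- An orbit is determined by any of its points. -/
theorem range_eq_of_apply_eq {χ : PolyField} {a : ℝ} {c c' : ℝ → E3}
    (hc : IsSolutionIn χ.toMap (torus a) c) (hc' : IsSolutionIn χ.toMap (torus a) c')
    {t t' : ℝ} (h : c t = c' t') : Set.range c = Set.range c' := by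
  have hshift : IsSolutionIn χ.toMap (torus a) (c' ∘ (· + (t' - t))) :=
    ⟨hc'.1.comp_add (t' - t), fun s => hc'.2 _⟩
  have heq := hc.eq_of_apply_eq (contDiff_toMap χ) (isCompact_torus a) hshift (t₀ := t)
    (by simp [h])
  rw [heq, (add_right_surjective (t' - t)).range_comp]

/-- An orbit through a zero of the field is reduced to that point. -/
theorem eq_of_toMap_eq_zero {χ : PolyField} {a : ℝ} {c : ℝ → E3}
    (hc : IsSolutionIn χ.toMap (torus a) c) {t : ℝ} (h : χ.toMap (c t) = 0) (s : ℝ) :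
    c s = c t := by
  have hconst : IsSolutionIn χ.toMap (torus a) (fun _ => c t) :=
    ⟨isIntegralCurve_const fun _ => h, fun _ => hc.2 t⟩
  exact congrFun (hc.eq_of_apply_eq (contDiff_toMap χ) (isCompact_torus a) hconst
    (t₀ := t) rfl) s

theorem toMap_eq_zero {a : ℝ} {f K' : Poly3} {p : E3} (hf : evalAt f p = 0)
    (hK : evalAt K' p = 0) : (cubicField a f K' 0 0).toMap p = 0 := by
  ext i
  fin_cases i
  · change evalAt (cubicField a f K' 0 0 0) p = 0
    rw [evalAt_cubicField_zero, hf, hK]; ring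
  · change evalAt (cubicField a f K' 0 0 1) p = 0
    rw [evalAt_cubicField_one, hf, hK]; ring
  · change evalAt (cubicField a f K' 0 0 2) p = 0
    rw [evalAt_cubicField_two, hK]; ring

/-- The neighbourhood isolating the meridian is the open half-space containing it, with the other
invariant plane removed. -/
theorem isLimitCycle_meridian_iff {a k α β : ℝ} (ha : 1 < a) {f K' : Poly3}
    (hf : ∀ p, evalAt f p = k * transverse α p * transverse β p)
    (hk : k * Real.sin (β - α) ≠ 0) :
    IsLimitCycle (cubicField a f K' 0 0).toMap (torus a) (meridian a α) ↔
      ¬ ∃ p ∈ meridian a α, evalAt K' p = 0 := by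
  have hf0 : ∀ p ∈ meridian a α, evalAt f p = 0 := fun p hp => by
    rw [hf, (mem_meridian_iff.1 hp).2.1]; ring
  constructor
  · rintro ⟨⟨c, hc, -, ⟨t, ht⟩, hrange⟩, -⟩ ⟨p, hp, hKp⟩
    obtain ⟨s, rfl⟩ : p ∈ Set.range c := hrange ▸ hp
    have hconst := eq_of_toMap_eq_zero hc (toMap_eq_zero (hf0 _ hp) hKp)
    exact ht ((hconst t).trans (hconst 0).symm)
  · intro hK
    push Not at hK
    obtain ⟨c, hc, hper, hrange⟩ := exists_periodic_solution_on_meridian ha hf0 hK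
    refine ⟨⟨c, hc, hper, ?_, hrange⟩, {p | 0 < radial α p ∧ transverse β p ≠ 0}, ?_, ?_, ?_⟩
    -- a constant solution would make the meridian a single point, but `z` takes the values `0`
    -- and `1` on it
    · by_contra! hconst
      have hsub : ∀ φ, meridianParam a α φ = c 0 := fun φ => by
        obtain ⟨t, ht⟩ : meridianParam a α φ ∈ Set.range c := by
          rw [hrange, ← range_meridianParam ha]; exact Set.mem_range_self φ
        rw [← ht, hconst]
      have h01 := congrArg (fun p : E3 => p 2) ((hsub 0).trans (hsub (Real.pi / 2)).symm)
      simp at h01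
    · exact (isOpen_lt continuous_const (continuous_radial α)).inter
        (isOpen_ne_fun (continuous_transverse β) continuous_const)
    · intro p hp
      obtain ⟨-, h0, hpos⟩ := mem_meridian_iff.1 hp
      refine ⟨hpos, ?_⟩
      rw [transverse_eq α β, h0, zero_mul, add_zero]
      exact mul_ne_zero hpos.ne' (right_ne_zero_of_mul hk)
    · rintro Γ' ⟨c', hc', ⟨T, hT, hper'⟩, -, rfl⟩ ⟨_, ⟨s, rfl⟩, hpos, hβ⟩
      rcases transverse_eq_zero_of_periodic ha hf hk hc' hT hper' with h0 | h0
      · obtain ⟨s', hs'⟩ : c' s ∈ Set.range c := by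
          rw [hrange]
          exact mem_meridian_of_transverse_eq_zero ha hc'.1.continuous hc'.2 h0 hpos s
        rw [range_eq_of_apply_eq hc' hc hs'.symm, hrange]
      · exact absurd (h0 s) hβ

/-! ### Attracting meridians -/

theorem infDist_meridian_le {a θ : ℝ} {p : E3} (hp : p ∈ torus a) (hpos : 0 < radial θ p) :
    Metric.infDist p (meridian a θ) ≤ 2 * |transverse θ p| := by
  set r := √(p 0 ^ 2 + p 1 ^ 2) with hr
  have hr2 : r ^ 2 = p 0 ^ 2 + p 1 ^ 2 := Real.sq_sqrt (by positivity)
  have hsum := radial_sq_add_transverse_sq θ p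
  have hle : radial θ p ≤ r := Real.le_sqrt_of_sq_le (by nlinarith [sq_nonneg (transverse θ p)])
  have hr0 : 0 < r := hpos.trans_le hle
  have htor : ((p 0) ^ 2 + (p 1) ^ 2 - a ^ 2) ^ 2 + (p 2) ^ 2 - 1 = 0 := hp
  have hq : !₂[r * Real.cos θ, r * Real.sin θ, p 2] ∈ meridian a θ := by
    refine ⟨?_, r, hr0, rfl, rfl⟩
    change ((r * Real.cos θ) ^ 2 + (r * Real.sin θ) ^ 2 - a ^ 2) ^ 2 + (p 2) ^ 2 - 1 = 0
    have e : (r * Real.cos θ) ^ 2 + (r * Real.sin θ) ^ 2 = p 0 ^ 2 + p 1 ^ 2 := by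
      rw [← hr2]; linear_combination r ^ 2 * Real.sin_sq_add_cos_sq θ
    rw [e]; exact htor
  refine (Metric.infDist_le_dist_of_mem hq).trans ?_
  rw [EuclideanSpace.dist_eq]
  refine Real.sqrt_le_iff.2 ⟨by positivity, ?_⟩
  simp only [Fin.sum_univ_three, Real.dist_eq, sq_abs]
  change (p 0 - r * Real.cos θ) ^ 2 + (p 1 - r * Real.sin θ) ^ 2 + (p 2 - p 2) ^ 2 ≤ _
  have e : (p 0 - r * Real.cos θ) ^ 2 + (p 1 - r * Real.sin θ) ^ 2 + (p 2 - p 2) ^ 2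
      = 2 * r * (r - radial θ p) := by
    simp only [radial]
    linear_combination -hr2 + r ^ 2 * Real.sin_sq_add_cos_sq θ
  rw [e, mul_pow, sq_abs]
  nlinarith

/-- Along a solution that starts where the ratio `transverse α / transverse β` is small, the
distance to the meridian at angle `α` decays exponentially. -/
theorem infDist_meridian_le_exp {a k α β η : ℝ} (ha : 1 < a) {f K' : Poly3}
    (hf : ∀ p, evalAt f p = k * transverse α p * transverse β p)
    (hk : k * Real.sin (β - α) < 0) (hη0 : 0 < η) (hη : η ≤ 1) {c : ℝ → E3}
    (hc : IsSolutionIn (cubicField a f K' 0 0).toMap (torus a) c)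
    (h0 : |Real.sin (β - α) * transverse α (c 0)| <
      η * (Real.sin (β - α) * transverse β (c 0))) {t : ℝ} (ht : 0 ≤ t) :
    Metric.infDist (c t) (meridian a α) ≤
      2 * (a ^ 2 + 1) * η * Real.exp (k * Real.sin (β - α) * (a ^ 2 - 1) * t) := by
  set s := Real.sin (β - α) with hs
  have hs0 : s ≠ 0 := right_ne_zero_of_mul hk.ne
  have hβ0 : 0 < s * transverse β (c 0) :=
    pos_of_mul_pos_right ((abs_nonneg _).trans_lt h0) hη0.le
  have hβpos : ∀ t, 0 < s * transverse β (c t) := by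
    intro t
    obtain ⟨E, hE, h⟩ := transverse_eq_mul_pos hc (θ := β) (g := fun p => k * transverse α p)
      ((continuous_transverse α).const_mul k |>.congr fun _ => rfl) (fun p => by rw [hf]) 0 t
    rw [h, ← mul_assoc]
    exact mul_pos hβ0 hE
  have hβne : ∀ t, transverse β (c t) ≠ 0 := fun t => right_ne_zero_of_mul (hβpos t).ne'
  have hw0 : |transverse α (c 0) / transverse β (c 0)| < η := by
    rw [← mul_div_mul_left _ _ hs0, abs_div, abs_of_pos hβ0, div_lt_iff₀ hβ0]
    exact h0
  set X := Real.exp (k * s * (a ^ 2 - 1) * t) with hX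
  have hX1 : X ≤ 1 := Real.exp_le_one_iff.2
    (mul_nonpos_of_nonpos_of_nonneg (mul_nonpos_of_nonpos_of_nonneg hk.le (by nlinarith)) ht)
  have hX0 : 0 < X := Real.exp_pos _
  have hwt : |transverse α (c t) / transverse β (c t)| < η * X := by
    rw [ratio_eq_mul_exp hc hf hβne 0 t, abs_mul, Real.abs_exp,
      intervalIntegral.integral_const_mul]
    refine mul_lt_mul_of_lt_of_le_of_nonneg_of_pos hw0 (Real.exp_le_exp.2 ?_) (abs_nonneg _) hX0
    rw [mul_assoc (k * s)]
    exact mul_le_mul_of_nonpos_left (integral_radius_sq_ge hc.1.continuous hc.2 ht) hk.le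
  rw [abs_div, div_lt_iff₀ (abs_pos.2 (hβne t))] at hwt
  have hηX : η * X ≤ 1 := mul_le_one₀ hη hX0.le hX1
  have hlt : |transverse α (c t)| < |transverse β (c t)| :=
    hwt.trans_le (mul_le_of_le_one_left (abs_nonneg _) hηX)
  -- `s · transverse β = s² · radial α + s cos (β - α) · transverse α`, and the last term is
  -- dominated by the left-hand side
  have hrad : 0 < radial α (c t) := by
    have h1 : |s * transverse α (c t) * Real.cos (β - α)| < s * transverse β (c t) := by
      rw [← abs_of_pos (hβpos t), abs_mul, abs_mul, abs_mul]
      calc |s| * |transverse α (c t)| * |Real.cos (β - α)|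
          ≤ |s| * |transverse α (c t)| :=
            mul_le_of_le_one_right (by positivity) (Real.abs_cos_le_one _)
        _ < |s| * |transverse β (c t)| := mul_lt_mul_of_pos_left hlt (abs_pos.2 hs0)
    have h2 := (abs_lt.1 h1).2
    have h3 : s * transverse β (c t) =
        s ^ 2 * radial α (c t) + s * transverse α (c t) * Real.cos (β - α) := by
      rw [transverse_eq α β]; ring
    have h4 : 0 < s ^ 2 * radial α (c t) := by linarith
    exact pos_of_mul_pos_right h4 (sq_nonneg s)
  have hβle : |transverse β (c t)| ≤ a ^ 2 + 1 := by
    refine abs_le_of_sq_le_sq ?_ (by positivity)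
    nlinarith [radial_sq_add_transverse_sq β (c t), sq_nonneg (radial β (c t)),
      (radius_sq_bounds (hc.2 t)).2, sq_nonneg a]
  calc Metric.infDist (c t) (meridian a α) ≤ 2 * |transverse α (c t)| :=
        infDist_meridian_le (hc.2 t) hrad
    _ ≤ 2 * (η * X * |transverse β (c t)|) := by linarith
    _ ≤ 2 * (η * X * (a ^ 2 + 1)) := by gcongr
    _ = 2 * (a ^ 2 + 1) * η * X := by ring

theorem exists_infDist_lt_imp_ratio_lt {a α β η : ℝ} (ha : 1 < a)
    (hs : Real.sin (β - α) ≠ 0) (hη : 0 < η) :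
    ∃ δ : ℝ, 0 < δ ∧ ∀ p : E3, Metric.infDist p (meridian a α) < δ →
      |Real.sin (β - α) * transverse α p| < η * (Real.sin (β - α) * transverse β p) := by
  have hopen : IsOpen {p : E3 | |Real.sin (β - α) * transverse α p| <
      η * (Real.sin (β - α) * transverse β p)} :=
    isOpen_lt ((continuous_transverse α).const_mul _).abs
      (((continuous_transverse β).const_mul _).const_mul _)
  obtain ⟨δ, hδ, hsub⟩ := (isCompact_meridian ha α).exists_thickening_subset_open hopen (by
    intro p hp
    obtain ⟨-, h0, hpos⟩ := mem_meridian_iff.1 hp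
    have e : η * (Real.sin (β - α) * (radial α p * Real.sin (β - α))) =
        η * (Real.sin (β - α) ^ 2 * radial α p) := by ring
    rw [Set.mem_ofPred_eq, transverse_eq α β, h0, mul_zero, abs_zero, zero_mul, add_zero, e]
    positivity)
  exact ⟨δ, hδ, fun p hp => hsub
    ((Metric.mem_thickening_iff_infDist_lt (meridian_nonempty ha α)).2 hp)⟩

theorem isAsymptoticallyStable_meridian {a k α β : ℝ} (ha : 1 < a) {f K' : Poly3}
    (hf : ∀ p, evalAt f p = k * transverse α p * transverse β p)
    (hk : k * Real.sin (β - α) < 0) :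
    IsAsymptoticallyStable (cubicField a f K' 0 0).toMap (torus a) (meridian a α) := by
  have hs0 : Real.sin (β - α) ≠ 0 := right_ne_zero_of_mul hk.ne
  have hrate : k * Real.sin (β - α) * (a ^ 2 - 1) < 0 :=
    mul_neg_of_neg_of_pos hk (by nlinarith)
  constructor
  · intro ε hε
    have hη : 0 < min 1 (ε / (4 * (a ^ 2 + 1))) := by positivity
    obtain ⟨δ, hδ, h⟩ := exists_infDist_lt_imp_ratio_lt ha hs0 hη
    refine ⟨δ, hδ, fun c hc h0 t ht => ?_⟩
    have h1 := infDist_meridian_le_exp ha hf hk hη (min_le_left _ _) hc (h _ h0) ht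
    have h2 : Real.exp (k * Real.sin (β - α) * (a ^ 2 - 1) * t) ≤ 1 :=
      Real.exp_le_one_iff.2 (mul_nonpos_of_nonpos_of_nonneg hrate.le ht)
    calc _ ≤ _ := h1
      _ ≤ 2 * (a ^ 2 + 1) * min 1 (ε / (4 * (a ^ 2 + 1))) * 1 := by gcongr
      _ ≤ 2 * (a ^ 2 + 1) * (ε / (4 * (a ^ 2 + 1))) * 1 := by gcongr; exact min_le_right _ _
      _ = ε / 2 := by field_simp; ring
      _ < ε := half_lt_self hε
  · obtain ⟨δ, hδ, h⟩ := exists_infDist_lt_imp_ratio_lt ha hs0 one_pos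
    refine ⟨δ, hδ, fun c hc h0 => ?_⟩
    have hlim : Filter.Tendsto (fun t => 2 * (a ^ 2 + 1) * 1 *
        Real.exp (k * Real.sin (β - α) * (a ^ 2 - 1) * t)) Filter.atTop (nhds 0) := by
      have := (Real.tendsto_exp_atBot.comp
        (Filter.tendsto_id.const_mul_atTop_of_neg hrate)).const_mul (2 * (a ^ 2 + 1) * 1)
      simpa only [mul_zero, Function.comp_def, id] using this
    refine squeeze_zero' (Filter.Eventually.of_forall fun t => Metric.infDist_nonneg) ?_ hlim
    filter_upwards [Filter.eventually_ge_atTop 0] with t ht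
    exact infDist_meridian_le_exp ha hf hk one_pos le_rfl hc (h _ h0) ht

/-! ### Invariant planes and the form of `f` -/

theorem exists_quadratic_coeffs {f : Poly3} (hf : f.totalDegree ≤ 2) :
    ∃ q₀ q₁ q₂ q₃ q₄ q₅ q₆ q₇ q₈ q₉ : ℝ, ∀ p : E3, evalAt f p =
      q₀ + q₁ * p 0 + q₂ * p 1 + q₃ * p 2 + q₄ * p 0 ^ 2 + q₅ * p 1 ^ 2 + q₆ * p 2 ^ 2 +
        q₇ * (p 0 * p 1) + q₈ * (p 0 * p 2) + q₉ * (p 1 * p 2) := by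
  rw [f.as_sum]
  refine Finset.sum_induction _ (fun g : Poly3 => ∃ q₀ q₁ q₂ q₃ q₄ q₅ q₆ q₇ q₈ q₉ : ℝ,
    ∀ p : E3, evalAt g p =
      q₀ + q₁ * p 0 + q₂ * p 1 + q₃ * p 2 + q₄ * p 0 ^ 2 + q₅ * p 1 ^ 2 + q₆ * p 2 ^ 2 +
        q₇ * (p 0 * p 1) + q₈ * (p 0 * p 2) + q₉ * (p 1 * p 2)) ?_ ?_ ?_
  · rintro g h ⟨a₀, a₁, a₂, a₃, a₄, a₅, a₆, a₇, a₈, a₉, hg⟩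
      ⟨b₀, b₁, b₂, b₃, b₄, b₅, b₆, b₇, b₈, b₉, hh⟩
    refine ⟨a₀ + b₀, a₁ + b₁, a₂ + b₂, a₃ + b₃, a₄ + b₄, a₅ + b₅, a₆ + b₆, a₇ + b₇, a₈ + b₈,
      a₉ + b₉, fun p => ?_⟩
    have : evalAt (g + h) p = evalAt g p + evalAt h p := by simp [evalAt]
    rw [this, hg, hh]; ring
  · exact ⟨0, 0, 0, 0, 0, 0, 0, 0, 0, 0, fun p => by simp [evalAt]⟩
  · intro d hd
    have hdeg : d 0 + d 1 + d 2 ≤ 2 := by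
      have := (le_totalDegree hd).trans hf
      rwa [Finsupp.sum_fintype _ _ (fun _ => rfl), Fin.sum_univ_three] at this
    generalize coeff d f = c
    have he : ∀ p : E3, evalAt (monomial d c) p =
        c * (p 0 ^ d 0 * p 1 ^ d 1 * p 2 ^ d 2) := fun p => by
      rw [evalAt, eval_monomial, Finsupp.prod_fintype _ _ (fun _ => pow_zero _),
        Fin.prod_univ_three]
    simp only [he]
    generalize d 0 = i at *
    generalize d 1 = j at *
    generalize d 2 = l at *
    let w : ℕ → ℕ → ℕ → ℝ := fun i' j' l' => if i = i' ∧ j = j' ∧ l = l' then c else 0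
    refine ⟨w 0 0 0, w 1 0 0, w 0 1 0, w 0 0 1, w 2 0 0, w 0 2 0, w 0 0 2, w 1 1 0, w 1 0 1,
      w 0 1 1, fun p => ?_⟩
    have hi : i ≤ 2 := by omega
    have hj : j ≤ 2 := by omega
    have hl : l ≤ 2 := by omega
    simp only [w]
    interval_cases i <;> interval_cases j <;> interval_cases l <;> first | omega | simp

/-- A polynomial of degree at most two that vanishes on two planes through the `z`-axis is a
multiple of the product of their equations. Vanishing is assumed off the `z`-axis only. -/
theorem exists_eq_mul_transverse_mul_transverse {f : Poly3} (hf : f.totalDegree ≤ 2) {α β : ℝ}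
    (hs : Real.sin (β - α) ≠ 0)
    (hα : ∀ p : E3, transverse α p = 0 → radial α p ≠ 0 → evalAt f p = 0)
    (hβ : ∀ p : E3, transverse β p = 0 → radial β p ≠ 0 → evalAt f p = 0) :
    ∃ k : ℝ, ∀ p, evalAt f p = k * transverse α p * transverse β p := by
  obtain ⟨q₀, q₁, q₂, q₃, q₄, q₅, q₆, q₇, q₈, q₉, hq⟩ := exists_quadratic_coeffs hf
  -- the coordinates `(s, t, z)` are adapted to the two planes `t = 0` and `s = 0`
  let P : ℝ → ℝ → ℝ → E3 := fun s t z => !₂[s * Real.cos α + t * Real.cos β,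
    s * Real.sin α + t * Real.sin β, z]
  obtain ⟨A, B, B', c, D, D', E, G, G', H, hF⟩ : ∃ A B B' c D D' E G G' H : ℝ, ∀ s t z,
      evalAt f (P s t z) = A + B * s + B' * t + c * z + D * s ^ 2 + D' * t ^ 2 + E * z ^ 2 +
        G * (s * z) + G' * (t * z) + H * (s * t) := by
    refine ⟨q₀, q₁ * Real.cos α + q₂ * Real.sin α, q₁ * Real.cos β + q₂ * Real.sin β, q₃,
      q₄ * Real.cos α ^ 2 + q₅ * Real.sin α ^ 2 + q₇ * Real.cos α * Real.sin α,
      q₄ * Real.cos β ^ 2 + q₅ * Real.sin β ^ 2 + q₇ * Real.cos β * Real.sin β, q₆,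
      q₈ * Real.cos α + q₉ * Real.sin α, q₈ * Real.cos β + q₉ * Real.sin β,
      2 * q₄ * Real.cos α * Real.cos β + 2 * q₅ * Real.sin α * Real.sin β +
        q₇ * (Real.cos α * Real.sin β + Real.cos β * Real.sin α), fun s t z => ?_⟩
    rw [hq]
    change q₀ + q₁ * (s * Real.cos α + t * Real.cos β) + q₂ * (s * Real.sin α + t * Real.sin β) +
      q₃ * z + q₄ * (s * Real.cos α + t * Real.cos β) ^ 2 +
      q₅ * (s * Real.sin α + t * Real.sin β) ^ 2 + q₆ * z ^ 2 +
      q₇ * ((s * Real.cos α + t * Real.cos β) * (s * Real.sin α + t * Real.sin β)) +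
      q₈ * ((s * Real.cos α + t * Real.cos β) * z) +
      q₉ * ((s * Real.sin α + t * Real.sin β) * z) = _
    ring
  have hFα : ∀ s z, s ≠ 0 → evalAt f (P s 0 z) = 0 := by
    intro s z hs0
    apply hα
    · change (s * Real.cos α + 0 * Real.cos β) * Real.sin α -
        (s * Real.sin α + 0 * Real.sin β) * Real.cos α = 0
      ring
    · change (s * Real.cos α + 0 * Real.cos β) * Real.cos α +
        (s * Real.sin α + 0 * Real.sin β) * Real.sin α ≠ 0
      intro h
      exact hs0 (by linear_combination h - s * Real.sin_sq_add_cos_sq α)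
  have hFβ : ∀ t z, t ≠ 0 → evalAt f (P 0 t z) = 0 := by
    intro t z ht0
    apply hβ
    · change (0 * Real.cos α + t * Real.cos β) * Real.sin β -
        (0 * Real.sin α + t * Real.sin β) * Real.cos β = 0
      ring
    · change (0 * Real.cos α + t * Real.cos β) * Real.cos β +
        (0 * Real.sin α + t * Real.sin β) * Real.sin β ≠ 0
      intro h
      exact ht0 (by linear_combination h - t * Real.sin_sq_add_cos_sq β)
  simp only [hF] at hFα hFβ
  have a1 := hFα 1 0 one_ne_zero
  have a2 := hFα (-1) 0 (by norm_num)
  have a3 := hFα 2 0 two_ne_zero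
  have a4 := hFα 1 1 one_ne_zero
  have a5 := hFα 1 (-1) one_ne_zero
  have a6 := hFα 2 1 two_ne_zero
  have b1 := hFβ 1 0 one_ne_zero
  have b2 := hFβ (-1) 0 (by norm_num)
  have b4 := hFβ 1 1 one_ne_zero
  have hA : A = 0 := by linarith
  have hB : B = 0 := by linarith
  have hD : D = 0 := by linarith
  have hG : G = 0 := by linarith
  have hE : E = 0 := by linarith
  have hc : c = 0 := by linarith
  have hB' : B' = 0 := by linarith
  have hD' : D' = 0 := by linarith
  have hG' : G' = 0 := by linarith
  refine ⟨-H / Real.sin (β - α) ^ 2, fun p => ?_⟩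
  have hp : p = P (transverse β p / Real.sin (β - α)) (-transverse α p / Real.sin (β - α)) (p 2) := by
    ext i
    fin_cases i
    · change p 0 = transverse β p / Real.sin (β - α) * Real.cos α +
        -transverse α p / Real.sin (β - α) * Real.cos β
      field_simp
      simp only [transverse, Real.sin_sub]; ring
    · change p 1 = transverse β p / Real.sin (β - α) * Real.sin α +
        -transverse α p / Real.sin (β - α) * Real.sin β
      field_simp
      simp only [transverse, Real.sin_sub]; ring
    · rfl
  conv_lhs => rw [hp, hF, hA, hB, hD, hG, hE, hc, hB', hD', hG']
  field_simp
  ring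

/-- The plane through the `z`-axis containing the meridian at angle `θ` is invariant. -/
def IsInvariantAngle (χ : PolyField) (θ : ℝ) : Prop :=
  ∃ m n : ℝ, (m, n) ≠ (0, 0) ∧ IsInvariantSurface χ (C m * X 0 + C n * X 1) ∧
    m * Real.cos θ + n * Real.sin θ = 0

theorem isInvariantMeridian_iff {a : ℝ} {χ : PolyField} {Γ : Set E3} :
    IsInvariantMeridian a χ Γ ↔ ∃ θ, IsInvariantAngle χ θ ∧ Γ = meridian a θ := by
  constructor
  · rintro ⟨m, n, h, hs, θ, h0, rfl⟩
    exact ⟨θ, ⟨m, n, h, hs, h0⟩, rfl⟩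
  · rintro ⟨θ, ⟨m, n, h, hs, h0⟩, rfl⟩
    exact ⟨m, n, h, hs, θ, h0, rfl⟩

theorem IsInvariantAngle.add_int_mul_pi {χ : PolyField} {θ : ℝ} (h : IsInvariantAngle χ θ)
    (j : ℤ) : IsInvariantAngle χ (θ + j * Real.pi) := by
  obtain ⟨m, n, h, hs, h0⟩ := h
  refine ⟨m, n, h, hs, ?_⟩
  rw [Real.cos_add_int_mul_pi, Real.sin_add_int_mul_pi]
  linear_combination (-1) ^ j * h0

theorem evalAt_applyPoly_linear (χ : PolyField) (m n : ℝ) (p : E3) :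
    evalAt (applyPoly χ (C m * X 0 + C n * X 1)) p = m * evalAt (χ 0) p + n * evalAt (χ 1) p := by
  simp [applyPoly, evalAt, Fin.sum_univ_three, pderiv_X]
  ring

theorem IsInvariantAngle.evalAt_eq {a : ℝ} {f K' : Poly3} {β γ θ : ℝ}
    (h : IsInvariantAngle (cubicField a f K' β γ) θ) {p : E3} (hp : transverse θ p = 0) :
    evalAt f p * radial θ p + (β * Real.sin θ - γ * Real.cos θ) * p 2 = 0 := by
  obtain ⟨m, n, hmn, ⟨k, hk⟩, h0⟩ := h
  have hm : m = (m * Real.sin θ - n * Real.cos θ) * Real.sin θ := by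
    linear_combination Real.cos θ * h0 - m * Real.sin_sq_add_cos_sq θ
  have hn : n = -(m * Real.sin θ - n * Real.cos θ) * Real.cos θ := by
    linear_combination Real.sin θ * h0 - n * Real.sin_sq_add_cos_sq θ
  set l := m * Real.sin θ - n * Real.cos θ with hl
  have hl0 : l ≠ 0 := by
    intro h
    rw [h] at hm hn
    exact hmn (by rw [hm, hn]; simp)
  have he := congrArg (evalAt · p) hk
  rw [evalAt_applyPoly_linear, evalAt_cubicField_zero, evalAt_cubicField_one] at he
  have hr : evalAt (k * (C m * X 0 + C n * X 1)) p = evalAt k p * (m * p 0 + n * p 1) := by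
    simp [evalAt]
  have hz : m * p 0 + n * p 1 = l * transverse θ p := by
    rw [hm, hn, transverse]; ring
  rw [hr, hz, hp] at he
  apply mul_left_cancel₀ hl0
  rw [mul_zero]
  have hz' := hz
  rw [hp, mul_zero] at hz'
  have hr' : m * p 1 - n * p 0 = l * radial θ p := by
    rw [hm, hn, radial]; ring
  have hβγ : m * β + n * γ = l * (β * Real.sin θ - γ * Real.cos θ) := by
    rw [hm, hn]; ring
  linear_combination he - evalAt f p * hr' - p 2 * hβγ -
    1 / 4 * (evalAt K' p * p 2) * hz'

theorem IsInvariantAngle.coeff_eq {a : ℝ} {f K' : Poly3} {β γ θ : ℝ}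
    (h : IsInvariantAngle (cubicField a f K' β γ) θ) : β * Real.sin θ = γ * Real.cos θ := by
  have h0 := h.evalAt_eq (p := !₂[0, 0, 1]) (by simp [transverse])
  simp [radial] at h0
  linarith

theorem IsInvariantAngle.evalAt_eq_zero {a : ℝ} {f K' : Poly3} {β γ θ : ℝ}
    (h : IsInvariantAngle (cubicField a f K' β γ) θ) {p : E3} (hp : transverse θ p = 0)
    (hr : radial θ p ≠ 0) : evalAt f p = 0 := by
  have h0 := h.evalAt_eq hp
  rw [h.coeff_eq, sub_self, zero_mul, add_zero] at h0
  exact (mul_eq_zero.1 h0).resolve_right hr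

theorem isInvariantAngle_of_eq_zero {a : ℝ} {K' : Poly3} (θ : ℝ) :
    IsInvariantAngle (cubicField a 0 K' 0 0) θ := by
  refine ⟨Real.sin θ, -Real.cos θ, ?_, ⟨C (1 / 4) * (K' * X 2), ?_⟩, by ring⟩
  · intro h
    have h1 := congrArg Prod.fst h
    have h2 := congrArg Prod.snd h
    simp only at h1 h2
    have := Real.sin_sq_add_cos_sq θ
    rw [h1, neg_eq_zero.1 h2] at this
    norm_num at this
  · simp [applyPoly, cubicField, Fin.sum_univ_three, pderiv_X]
    ring

theorem infinite_setOf_meridian {a : ℝ} (ha : 1 < a) :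
    (Set.range (meridian a)).Infinite := by
  refine Set.Infinite.mono (Set.image_subset_range _ (Set.Icc 0 Real.pi)) ?_
  refine (Set.Icc_infinite Real.pi_pos).image fun θ hθ θ' hθ' h => ?_
  exact Real.injOn_cos hθ hθ' (cos_eq_and_sin_eq_of_meridian_eq ha h).1

theorem meridian_eq_of_sin_sub_eq_zero {a θ α : ℝ} (h : Real.sin (θ - α) = 0) :
    meridian a θ = meridian a α ∨ meridian a θ = meridian a (α + Real.pi) := by
  have hc : Real.cos θ = Real.cos α * Real.cos (θ - α) := by
    conv_lhs => rw [← add_sub_cancel α θ, Real.cos_add, h]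
    ring
  have hs : Real.sin θ = Real.sin α * Real.cos (θ - α) := by
    conv_lhs => rw [← add_sub_cancel α θ, Real.sin_add, h]
    ring
  rcases Real.sin_eq_zero_iff_cos_eq.1 h with h1 | h1
  · left; apply meridian_congr <;> simp [hc, hs, h1]
  · right; apply meridian_congr <;> simp [hc, hs, h1]

/-- Two invariant planes exist, and the second one may be described by an angle in the half-turn
following the first. -/
theorem exists_two_isInvariantAngle {a : ℝ} {χ : PolyField}
    (hfour : {Γ : Set E3 | IsInvariantMeridian a χ Γ}.ncard = 4) :
    ∃ α β : ℝ, α < β ∧ β < α + Real.pi ∧ IsInvariantAngle χ α ∧ IsInvariantAngle χ β := by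
  obtain ⟨Γ, hΓ⟩ : {Γ : Set E3 | IsInvariantMeridian a χ Γ}.Nonempty :=
    Set.nonempty_of_ncard_ne_zero (by omega)
  obtain ⟨α, hα, rfl⟩ := isInvariantMeridian_iff.1 hΓ
  obtain ⟨Γ', hΓ', hne⟩ : ∃ Γ', IsInvariantMeridian a χ Γ' ∧
      Γ' ∉ ({meridian a α, meridian a (α + Real.pi)} : Set (Set E3)) := by
    by_contra! hsub
    have h1 := Set.ncard_le_ncard (s := {Γ : Set E3 | IsInvariantMeridian a χ Γ}) hsub
      (Set.toFinite _)
    have h2 := Set.ncard_insert_le (meridian a α) {meridian a (α + Real.pi)}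
    rw [Set.ncard_singleton] at h2
    omega
  obtain ⟨β, hβ, rfl⟩ := isInvariantMeridian_iff.1 hΓ'
  have hs : Real.sin (β - α) ≠ 0 := fun h => hne (meridian_eq_of_sin_sub_eq_zero h)
  obtain ⟨h1, h2⟩ := toIcoMod_mem_Ico Real.pi_pos α β
  have hmod : toIcoMod Real.pi_pos α β = β + ((-toIcoDiv Real.pi_pos α β : ℤ) : ℝ) * Real.pi := by
    rw [toIcoMod, zsmul_eq_mul]; push_cast; ring
  refine ⟨α, toIcoMod Real.pi_pos α β, lt_of_le_of_ne h1 fun h => hs ?_, h2, hα, ?_⟩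
  · have e : β - α = (toIcoDiv Real.pi_pos α β : ℤ) * Real.pi := by
      rw [← h] at hmod
      push_cast at hmod
      linarith
    rw [e, Real.sin_int_mul_pi]
  · rw [hmod]
    exact hβ.add_int_mul_pi _

/-- With exactly four invariant meridians, the field is determined up to `K'` by two angles and a
constant, which can be chosen so that the meridian at angle `α` attracts. -/
theorem exists_normal_form {a : ℝ} (ha : 1 < a) {f K' : Poly3} {b c : ℝ}
    (hf : f.totalDegree ≤ 2)
    (hfour : {Γ : Set E3 | IsInvariantMeridian a (cubicField a f K' b c) Γ}.ncard = 4) :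
    b = 0 ∧ c = 0 ∧ ∃ k α β : ℝ, k < 0 ∧ α < β ∧ β < α + Real.pi ∧
      (∀ p, evalAt f p = k * transverse α p * transverse β p) ∧
      {Γ : Set E3 | IsInvariantMeridian a (cubicField a f K' b c) Γ} =
        Set.range fun i => meridian a (![α, β, α + Real.pi, β + Real.pi] i) := by
  obtain ⟨α, β, h1, h2, hα, hβ⟩ := exists_two_isInvariantAngle hfour
  have hs : 0 < Real.sin (β - α) := Real.sin_pos_of_pos_of_lt_pi (by linarith) (by linarith)
  have hb : b * Real.sin (β - α) = 0 := by
    rw [Real.sin_sub]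
    linear_combination Real.cos α * hβ.coeff_eq - Real.cos β * hα.coeff_eq
  have hc : c * Real.sin (β - α) = 0 := by
    rw [Real.sin_sub]
    linear_combination Real.sin α * hβ.coeff_eq - Real.sin β * hα.coeff_eq
  have hb0 : b = 0 := (mul_eq_zero.1 hb).resolve_right hs.ne'
  have hc0 : c = 0 := (mul_eq_zero.1 hc).resolve_right hs.ne'
  obtain ⟨k, hk⟩ := exists_eq_mul_transverse_mul_transverse hf hs.ne'
    (fun p hp hr => hα.evalAt_eq_zero hp hr) (fun p hp hr => hβ.evalAt_eq_zero hp hr)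
  have hk0 : k ≠ 0 := by
    rintro rfl
    have hf0 : f = 0 := MvPolynomial.funext fun x => by
      have := hk (WithLp.toLp 2 x)
      simpa [evalAt] using this
    subst hf0 hb0 hc0
    have hall : {Γ : Set E3 | IsInvariantMeridian a (cubicField a 0 K' 0 0) Γ} =
        Set.range (meridian a) := by
      ext Γ
      rw [Set.mem_ofPred_eq, isInvariantMeridian_iff]
      exact ⟨fun ⟨θ, _, h⟩ => ⟨θ, h.symm⟩, fun ⟨θ, h⟩ => ⟨θ, isInvariantAngle_of_eq_zero θ, h.symm⟩⟩
    rw [hall, (infinite_setOf_meridian ha).ncard] at hfour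
    omega
  have hαπ : IsInvariantAngle (cubicField a f K' b c) (α + Real.pi) := by
    simpa using hα.add_int_mul_pi 1
  have hβπ : IsInvariantAngle (cubicField a f K' b c) (β + Real.pi) := by
    simpa using hβ.add_int_mul_pi 1
  have hset : ∀ Γ, IsInvariantMeridian a (cubicField a f K' b c) Γ ↔
      Γ = meridian a α ∨ Γ = meridian a β ∨ Γ = meridian a (α + Real.pi) ∨
        Γ = meridian a (β + Real.pi) := by
    intro Γ
    rw [isInvariantMeridian_iff]
    constructor
    · rintro ⟨θ, hθ, rfl⟩
      have hz := hθ.evalAt_eq_zero (p := !₂[Real.cos θ, Real.sin θ, 0])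
        (by simp [transverse, mul_comm])
        (by
          have := Real.sin_sq_add_cos_sq θ
          simp only [radial]
          change Real.cos θ * Real.cos θ + Real.sin θ * Real.sin θ ≠ 0
          nlinarith)
      have ht : ∀ ψ, transverse ψ !₂[Real.cos θ, Real.sin θ, 0] = -Real.sin (θ - ψ) := fun ψ => by
        simp [transverse, Real.sin_sub, mul_comm]
      rw [hk, ht, ht, mul_assoc, mul_eq_zero, neg_mul_neg, mul_eq_zero] at hz
      rcases hz.resolve_left hk0 with h | h
      · rcases meridian_eq_of_sin_sub_eq_zero (a := a) h with h | h <;> simp [h]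
      · rcases meridian_eq_of_sin_sub_eq_zero (a := a) h with h | h <;> simp [h]
    · rintro (rfl | rfl | rfl | rfl)
      exacts [⟨_, hα, rfl⟩, ⟨_, hβ, rfl⟩, ⟨_, hαπ, rfl⟩, ⟨_, hβπ, rfl⟩]
  refine ⟨hb0, hc0, ?_⟩
  rcases hk0.lt_or_gt with hneg | hpos
  · refine ⟨k, α, β, hneg, h1, h2, hk, ?_⟩
    ext Γ
    simp only [Set.mem_ofPred_eq, hset, Set.mem_range, Fin.exists_fin_succ]
    simp [eq_comm]
  · -- otherwise the roles of the two planes are exchanged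
    refine ⟨-k, β, α + Real.pi, neg_neg_of_pos hpos, h2, by linarith,
      fun p => by rw [hk, transverse_add_pi]; ring, ?_⟩
    have h2π : meridian a (α + Real.pi + Real.pi) = meridian a α := by
      rw [add_assoc, ← two_mul, meridian_add_two_pi]
    ext Γ
    simp only [Set.mem_ofPred_eq, hset, Set.mem_range, Fin.exists_fin_succ]
    simp [eq_comm, h2π]
    tauto

end PolyField

/-! ### Limit cycles among the invariant meridians -/

theorem theorem2p4 (a : ℝ) (ha : 1 < a) (f K' : Poly3) (β γ : ℝ)
    (hf : f.totalDegree ≤ 2) (hK : (K' * X 2).totalDegree ≤ 2)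
    (χ : PolyField) (hχ : χ = PolyField.cubicField a f K' β γ)
    (hfour : {Γ : Set E3 | PolyField.IsInvariantMeridian a χ Γ}.ncard = 4) :
    -- each invariant meridian is a limit cycle iff `K' = 0` has no solution on it
    (∀ Γ : Set E3, PolyField.IsInvariantMeridian a χ Γ →
      (IsLimitCycle χ.toMap (PolyField.torus a) Γ ↔
        ¬ ∃ p ∈ Γ, PolyField.evalAt K' p = 0)) ∧
    -- all of them are limit cycles iff `K' = 0` has no solution on any of them
    ((∀ Γ : Set E3, PolyField.IsInvariantMeridian a χ Γ →
        IsLimitCycle χ.toMap (PolyField.torus a) Γ) ↔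
      ¬ ∃ Γ : Set E3, PolyField.IsInvariantMeridian a χ Γ ∧
        ∃ p ∈ Γ, PolyField.evalAt K' p = 0) ∧
    -- in that case, going around the torus, they are alternately stable and unstable
    ((∀ Γ : Set E3, PolyField.IsInvariantMeridian a χ Γ →
        IsLimitCycle χ.toMap (PolyField.torus a) Γ) →
      ∃ θ : Fin 4 → ℝ, StrictMono θ ∧ θ 3 < θ 0 + 2 * Real.pi ∧
        {Γ : Set E3 | PolyField.IsInvariantMeridian a χ Γ} =
          Set.range (fun i => PolyField.meridian a (θ i)) ∧
        IsStableLimitCycle χ.toMap (PolyField.torus a) (PolyField.meridian a (θ 0)) ∧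
        IsUnstableLimitCycle χ.toMap (PolyField.torus a) (PolyField.meridian a (θ 1)) ∧
        IsStableLimitCycle χ.toMap (PolyField.torus a) (PolyField.meridian a (θ 2)) ∧
        IsUnstableLimitCycle χ.toMap (PolyField.torus a) (PolyField.meridian a (θ 3))) := by
  subst hχ
  obtain ⟨rfl, rfl, k, α, δ, hk, h1, h2, hfac, hset⟩ :=
    PolyField.exists_normal_form ha hf hfour
  have hs : 0 < Real.sin (δ - α) := Real.sin_pos_of_pos_of_lt_pi (by linarith) (by linarith)
  have hpi : ∀ θ p, PolyField.transverse (θ + Real.pi) p = -PolyField.transverse θ p :=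
    PolyField.transverse_add_pi
  have hs₁ : Real.sin (δ - (α + Real.pi)) = -Real.sin (δ - α) := by
    rw [← sub_sub, Real.sin_sub_pi]
  have hs₂ : Real.sin (α - δ) = -Real.sin (δ - α) := by rw [← Real.sin_neg, neg_sub]
  have hs₃ : Real.sin (α - (δ + Real.pi)) = Real.sin (δ - α) := by
    rw [← sub_sub, Real.sin_sub_pi, hs₂, neg_neg]
  have hne : k * Real.sin (δ - α) ≠ 0 := (mul_neg_of_neg_of_pos hk hs).ne
  -- `f` factors through the equation of each of the four meridians, up to the sign of `k`
  have hcycle : ∀ Γ : Set E3, PolyField.IsInvariantMeridian a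
      (PolyField.cubicField a f K' 0 0) Γ →
      (IsLimitCycle (PolyField.cubicField a f K' 0 0).toMap (PolyField.torus a) Γ ↔
        ¬ ∃ p ∈ Γ, PolyField.evalAt K' p = 0) := by
    intro Γ hΓ
    obtain ⟨i, rfl⟩ := hset.subset hΓ
    fin_cases i
    · exact PolyField.isLimitCycle_meridian_iff ha hfac hne
    · exact PolyField.isLimitCycle_meridian_iff (k := k) (α := δ) (β := α) ha
        (fun p => by rw [hfac]; ring) (by rw [hs₂, mul_neg]; exact neg_ne_zero.2 hne)
    · exact PolyField.isLimitCycle_meridian_iff (k := -k) (α := α + Real.pi) (β := δ) ha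
        (fun p => by rw [hfac, hpi]; ring) (by rwa [hs₁, neg_mul_neg])
    · exact PolyField.isLimitCycle_meridian_iff (k := -k) (α := δ + Real.pi) (β := α) ha
        (fun p => by rw [hfac, hpi]; ring) (by rw [hs₃, neg_mul]; exact neg_ne_zero.2 hne)
  refine ⟨hcycle, ?_, fun hall => ?_⟩
  · constructor
    · rintro hall ⟨Γ, hΓ, hzero⟩
      exact (hcycle Γ hΓ).1 (hall Γ hΓ) hzero
    · intro hno Γ hΓ
      exact (hcycle Γ hΓ).2 fun hzero => hno ⟨Γ, hΓ, hzero⟩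
  have hmem : ∀ i : Fin 4, IsLimitCycle (PolyField.cubicField a f K' 0 0).toMap
      (PolyField.torus a)
      (PolyField.meridian a (![α, δ, α + Real.pi, δ + Real.pi] i)) := fun i =>
    hall _ (hset.superset (Set.mem_range_self i))
  have hneg : ∀ p, PolyField.evalAt (-f) p =
      -k * PolyField.transverse α p * PolyField.transverse δ p := fun p => by
    have : PolyField.evalAt (-f) p = -PolyField.evalAt f p := by simp [PolyField.evalAt]
    rw [this, hfac]; ring
  refine ⟨![α, δ, α + Real.pi, δ + Real.pi], ?_, ?_, hset, ⟨hmem 0, ?_⟩, ⟨hmem 1, ?_⟩,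
    ⟨hmem 2, ?_⟩, ⟨hmem 3, ?_⟩⟩
  · refine Fin.strictMono_iff_lt_succ.2 fun i => ?_
    fin_cases i
    · exact h1
    · exact h2
    · exact add_lt_add_left h1 Real.pi
  · change δ + Real.pi < α + 2 * Real.pi
    linarith
  · exact PolyField.isAsymptoticallyStable_meridian ha hfac (mul_neg_of_neg_of_pos hk hs)
  · rw [PolyField.neg_toMap_cubicField, neg_zero]
    exact PolyField.isAsymptoticallyStable_meridian (k := -k) (α := δ) (β := α) ha
      (fun p => by rw [hneg]; ring)
      (by rw [hs₂, neg_mul_neg]; exact mul_neg_of_neg_of_pos hk hs)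
  · exact PolyField.isAsymptoticallyStable_meridian (k := -k) (α := α + Real.pi) (β := δ) ha
      (fun p => by rw [hfac, hpi]; ring)
      (by rw [hs₁, neg_mul_neg]; exact mul_neg_of_neg_of_pos hk hs)
  · rw [PolyField.neg_toMap_cubicField, neg_zero]
    exact PolyField.isAsymptoticallyStable_meridian (k := k) (α := δ + Real.pi) (β := α) ha
      (fun p => by rw [hneg, hpi]; ring)
      (by rw [hs₃]; exact mul_neg_of_neg_of_pos hk hs)
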